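/- Let $n\ge 1$ and let $\mathfrak{S}_n$ be the symmetric group on $[n]=\{1,\dots,n\}$. For $\sigma\in\mathfrak{S}_n$ let $\mathrm{inv}(\sigma)$ be the number of pairs $i<j$ with $\sigma(i)>\sigma(j)$, let $\mathrm{exc}(\sigma)$ be the number of $i\in[n]$ with $\sigma(i)>i$, and let $$\mathrm{depth}(\sigma)=\min\Big\{\sum_{r=1}^{k}(j_r-i_r) : k\ge 0,\ \sigma=(i_1\,j_1)(i_2\,j_2)\cdots(i_k\,j_k),\ 1\le i_r<j_r\le n\Big\}.$$ Define the Euler numbers $E_n$ by $\sum_{n\ge 0}E_n\frac{z^n}{n!}=\tan z+\sec z$; for $n$ odd, $E_n$ is a tangent number. There is an involution $\sigma\mapsto\sigma'$ on $\mathfrak{S}_n$ such that for all $\sigma$ $$\mathrm{depth}(\sigma)-\mathrm{depth}(\sigma')=\mathrm{exc}(\sigma)-\mathrm{exc}(\sigma')=\mathrm{inv}(\sigma)-\mathrm{inv}(\sigma')\in\{1,0,-1\},$$ where the common difference is $0$ only if $\sigma'=\sigma$ (so the involution reverses the parities of depth and excedance number off its fixed points). The involution has no fixed point if $n$ is even;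 if $n$ is odd, it has exactly $E_n$ fixed points, and each fixed point $\sigma$ has $\mathrm{depth}(\sigma)$ even and $\mathrm{exc}(\sigma)\equiv\frac{n-1}{2}\pmod 2$. Consequently, $$\sum_{\sigma\in\mathfrak{S}_n}(-1)^{\mathrm{depth}(\sigma)}=\begin{cases}E_n & n \text{ odd}\\ 0 & n\text{ even,}\end{cases}\qquad \sum_{\sigma\in\mathfrak{S}_n}(-1)^{\mathrm{exc}(\sigma)}=\begin{cases}(-1)^{\frac{n-1}{2}}E_n & n \text{ odd}\\ 0 & n\text{ even.}\end{cases}$$ -/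

import Mathlib

namespace PermDepth

/-- `IsFactorization σ L` : the list `L = [(i₁, j₁), …, (i_k, j_k)]` satisfies `i_r < j_r` for all
`r`, and `σ = (i₁ j₁) (i₂ j₂) ⋯ (i_k j_k)` as a product of transpositions. -/
def IsFactorization {n : ℕ} (σ : Equiv.Perm (Fin n)) (L : List (Fin n × Fin n)) : Prop :=
  (∀ p ∈ L, p.1 < p.2) ∧ (L.map (fun p => Equiv.swap p.1 p.2)).prod = σ

/-- The cost `∑ (j_r - i_r)` of a list of pairs `i_r < j_r`. -/
def cost {n : ℕ} (L : List (Fin n × Fin n)) : ℕ :=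
  (L.map (fun p => (p.2 : ℕ) - (p.1 : ℕ))).sum

/-- Every permutation of `Fin n` is a product of transpositions `(i j)` with `i < j`, so that the
minimum in the definition of the depth is over a nonempty set. -/
theorem exists_isFactorization {n : ℕ} (σ : Equiv.Perm (Fin n)) :
    ∃ L : List (Fin n × Fin n), IsFactorization σ L := by
  induction σ using Equiv.Perm.swap_induction_on with
  | one => exact ⟨[], by simp [IsFactorization]⟩
  | swap_mul f x y hxy ih =>
    obtain ⟨L, hL, hprod⟩ := ih
    rcases lt_or_gt_of_ne hxy with h | h
    · exact ⟨(x, y) :: L, by simpa [h] using hL, by simp [hprod]⟩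
    · exact ⟨(y, x) :: L, by simpa [h] using hL, by simp [hprod, Equiv.swap_comm]⟩

/-- The depth of `σ` : the least cost of a factorization of `σ` into transpositions. -/
noncomputable def depth {n : ℕ} (σ : Equiv.Perm (Fin n)) : ℕ :=
  sInf {d : ℕ | ∃ L : List (Fin n × Fin n), IsFactorization σ L ∧ cost L = d}

/-- The number of excedances, i.e. of indices `i` with `σ i > i`. -/
def exc {n : ℕ} (σ : Equiv.Perm (Fin n)) : ℕ :=
  (Finset.univ.filter (fun i : Fin n => i < σ i)).card

/-- The number of inversions, i.e. of pairs `i < j` with `σ i > σ j`. -/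
def inv {n : ℕ} (σ : Equiv.Perm (Fin n)) : ℕ :=
  (Finset.univ.filter (fun p : Fin n × Fin n => p.1 < p.2 ∧ σ p.2 < σ p.1)).card

/-- The Euler numbers, defined by `∑ E_n zⁿ / n! = tan z + sec z`, with `tan z = sin z / cos z` and
`sec z = 1 / cos z` as formal power series over `ℚ`. -/
noncomputable def euler (n : ℕ) : ℚ :=
  (n.factorial : ℚ) * PowerSeries.coeff n
    (PowerSeries.sin ℚ * (PowerSeries.cos ℚ)⁻¹ + (PowerSeries.cos ℚ)⁻¹)

end PermDepth

/-! The depth equals the sum of `σ x - x` over excedances (`depth_eq_displacement`), that is, the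
sum of the excedance values minus the sum of the excedance positions.

For consecutive `i` and `j = i + 1`, look at whether `i` is an excedance position and `j` an
excedance value. If neither holds ("low") or both hold ("high"), there is a bijection between the
two cases. It changes no other excedance position or value, so going from low to high adds 1 to exc
and `j - i = 1` to the depth. A rank-matching rule makes it add 1 to inv too (`inv_toHigh`).
Applying it at the first available `i` is an involution, since the status at earlier indices is
unchanged.

At a fixed point exactly one of the two conditions holds for every `i`. Summing over `i` gives `2
exc = n - 1` and an even depth (`fixed_two_mul_exc`, `fixed_spec`).

The fixed points are counted by their sign. The signed excedance sum is evaluated independently by a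
differential recurrence solved by the tangent series (`sum_neg_one_pow_exc`), and the involution
equates it with the signed number of fixed points (`card_fixed`). The depth sum follows. -/

namespace PermDepth

/-! ### Depth as displacement over excedances -/

/-- The total displacement `∑ (σ i - i)` over the excedances of `σ`. -/
def displacement {n : ℕ} (σ : Equiv.Perm (Fin n)) : ℕ :=
  ∑ i, ((σ i : ℕ) - (i : ℕ))

lemma sum_eq_add_add_sum_compl {n : ℕ} {M : Type*} [AddCommMonoid M] {x y : Fin n} (h : x ≠ y)
    (f : Fin n → M) : ∑ z, f z = f x + f y + ∑ z ∈ ({x, y} : Finset (Fin n))ᶜ, f z := by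
  rw [← Finset.sum_add_sum_compl {x, y}, Finset.sum_pair h]

/-- Only the terms at `x` and `y` change, and the positive part (truncated subtraction) is monotone
and 1-Lipschitz. This is the lower bound for the depth. -/
lemma displacement_mul_swap_le {n : ℕ} (σ : Equiv.Perm (Fin n)) {x y : Fin n} (h : x < y) :
    displacement σ ≤ displacement (σ * Equiv.swap x y) + ((y : ℕ) - x) := by
  unfold displacement
  rw [sum_eq_add_add_sum_compl h.ne, sum_eq_add_add_sum_compl h.ne]
  have : ∑ z ∈ ({x, y} : Finset (Fin n))ᶜ, (((σ * Equiv.swap x y) z : ℕ) - (z : ℕ)) =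
      ∑ z ∈ ({x, y} : Finset (Fin n))ᶜ, ((σ z : ℕ) - (z : ℕ)) := by
    refine Finset.sum_congr rfl fun z hz => ?_
    simp only [Finset.mem_compl, Finset.mem_insert, Finset.mem_singleton, not_or] at hz
    rw [Equiv.Perm.mul_apply, Equiv.swap_apply_of_ne_of_ne hz.1 hz.2]
  rw [this]
  simp only [Equiv.Perm.mul_apply, Equiv.swap_apply_left, Equiv.swap_apply_right]
  have := Fin.lt_def.1 h
  omega

lemma displacement_mul_swap_of_le {n : ℕ} (σ : Equiv.Perm (Fin n)) {x y : Fin n} (h : x < y)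
    (hx : y ≤ σ x) (hy : σ y ≤ x) :
    displacement σ = displacement (σ * Equiv.swap x y) + ((y : ℕ) - x) := by
  unfold displacement
  rw [sum_eq_add_add_sum_compl h.ne, sum_eq_add_add_sum_compl h.ne]
  have : ∑ z ∈ ({x, y} : Finset (Fin n))ᶜ, (((σ * Equiv.swap x y) z : ℕ) - (z : ℕ)) =
      ∑ z ∈ ({x, y} : Finset (Fin n))ᶜ, ((σ z : ℕ) - (z : ℕ)) := by
    refine Finset.sum_congr rfl fun z hz => ?_
    simp only [Finset.mem_compl, Finset.mem_insert, Finset.mem_singleton, not_or] at hz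
    rw [Equiv.Perm.mul_apply, Equiv.swap_apply_of_ne_of_ne hz.1 hz.2]
  rw [this]
  simp only [Equiv.Perm.mul_apply, Equiv.swap_apply_left, Equiv.swap_apply_right]
  have := Fin.lt_def.1 h
  have := Fin.le_def.1 hx
  have := Fin.le_def.1 hy
  omega

lemma displacement_one {n : ℕ} : displacement (1 : Equiv.Perm (Fin n)) = 0 := by
  simp [displacement]

lemma displacement_le_cost {n : ℕ} (L : List (Fin n × Fin n)) :
    ∀ σ : Equiv.Perm (Fin n), IsFactorization σ L → displacement σ ≤ cost L := by
  induction L using List.reverseRecOn with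
  | nil =>
    rintro σ ⟨-, h⟩
    simp only [List.map_nil, List.prod_nil] at h
    simp [← h, displacement_one]
  | append_singleton L p ih =>
    rintro σ ⟨hL, hσ⟩
    have hp : p.1 < p.2 := hL p (by simp)
    have h1 := ih (σ * Equiv.swap p.1 p.2)
      ⟨fun q hq => hL q (by simp [hq]), by rw [← hσ]; simp [mul_assoc]⟩
    have h2 := displacement_mul_swap_le σ hp
    simp only [cost, List.map_append, List.sum_append, List.map_cons, List.map_nil,
      List.sum_cons, List.sum_nil, add_zero] at h1 ⊢
    omega

lemma exists_lt_of_ne_one {n : ℕ} {σ : Equiv.Perm (Fin n)} (h : σ ≠ 1) : ∃ x, x < σ x := by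
  by_contra! hle
  apply h
  have hsum : ∑ x, (σ x : ℕ) = ∑ x : Fin n, (x : ℕ) := Equiv.sum_comp σ (fun x => (x : ℕ))
  ext x
  rw [Equiv.Perm.one_apply]
  exact (Finset.sum_eq_sum_iff_of_le fun i _ => Fin.le_def.1 (hle i)).1 hsum x (Finset.mem_univ x)

/-- Take `x` to be the largest excedance position. If no such `y` existed, `σ` would map the
interval `[x, σ x]` injectively into `(x, σ x]`, which has one element fewer. Swapping the pair
found here lowers the displacement by exactly its cost. -/
lemma exists_le_and_le_of_ne_one {n : ℕ} {σ : Equiv.Perm (Fin n)} (h : σ ≠ 1) :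
    ∃ x y, x < y ∧ y ≤ σ x ∧ σ y ≤ x := by
  obtain ⟨x, hx, hmax⟩ := (Finset.univ.filter fun x => x < σ x).exists_maximal
    (by obtain ⟨x, hx⟩ := exists_lt_of_ne_one h; exact ⟨x, by simpa using hx⟩)
  simp only [Finset.mem_filter, Finset.mem_univ, true_and] at hx hmax
  by_contra! hno
  have hmaps : ∀ y ∈ Finset.Icc x (σ x), σ y ∈ Finset.Ioc x (σ x) := by
    intro y hy
    rw [Finset.mem_Icc] at hy
    rw [Finset.mem_Ioc]
    rcases hy.1.eq_or_lt with rfl | hxy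
    · exact ⟨hx, le_rfl⟩
    · refine ⟨hno x y hxy hy.2, ?_⟩
      by_contra! hlt
      exact absurd (hmax (hy.2.trans_lt hlt) hxy.le) (not_le.2 hxy)
  have := Finset.card_le_card_of_injOn σ hmaps σ.injective.injOn
  rw [Fin.card_Icc, Fin.card_Ioc] at this
  have := Fin.lt_def.1 hx
  omega

lemma exists_isFactorization_cost_eq {n : ℕ} (d : ℕ) :
    ∀ σ : Equiv.Perm (Fin n), displacement σ = d → ∃ L, IsFactorization σ L ∧ cost L = d := by
  induction d using Nat.strong_induction_on with
  | _ d ih =>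
    intro σ hd
    by_cases h : σ = 1
    · subst h
      exact ⟨[], by simp [IsFactorization], by rw [← hd, displacement_one]; rfl⟩
    · obtain ⟨x, y, hxy, hx, hy⟩ := exists_le_and_le_of_ne_one h
      have hD := displacement_mul_swap_of_le σ hxy hx hy
      have := Fin.lt_def.1 hxy
      obtain ⟨L, ⟨hL, hp⟩, hc⟩ := ih _ (by omega) (σ * Equiv.swap x y) rfl
      refine ⟨L ++ [(x, y)], ⟨?_, ?_⟩, ?_⟩
      · intro q hq
        rcases List.mem_append.1 hq with hq | hq
        · exact hL q hq
        · rw [List.mem_singleton.1 hq]; exact hxy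
      · simp [hp]
      · simp only [cost] at hc
        simp only [cost, List.map_append, List.sum_append, List.map_cons, List.map_nil,
          List.sum_cons, List.sum_nil, add_zero]
        omega

theorem depth_eq_displacement {n : ℕ} (σ : Equiv.Perm (Fin n)) : depth σ = displacement σ := by
  apply le_antisymm
  · exact Nat.sInf_le (exists_isFactorization_cost_eq _ σ rfl)
  · obtain ⟨L, hL, hc⟩ := Nat.sInf_mem (s := {d : ℕ | ∃ L, IsFactorization σ L ∧ cost L = d})
      (by obtain ⟨L, hL⟩ := exists_isFactorization σ; exact ⟨_, L, hL, rfl⟩)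
    rw [depth, ← hc]
    exact displacement_le_cost L σ hL

/-- The depth is the sum of the excedance values minus the sum of the excedance positions. -/
lemma depth_add_sum {n : ℕ} (σ : Equiv.Perm (Fin n)) :
    depth σ + ∑ x with x < σ x, (x : ℕ) = ∑ y with σ⁻¹ y < y, (y : ℕ) := by
  rw [depth_eq_displacement, displacement, Finset.sum_filter, Finset.sum_filter,
    ← Finset.sum_add_distrib, ← Equiv.sum_comp σ fun y => if σ⁻¹ y < y then (y : ℕ) else 0]
  refine Finset.sum_congr rfl fun x _ => ?_
  simp only [Equiv.Perm.inv_def, Equiv.symm_apply_apply, Fin.lt_def]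
  split_ifs <;> omega

lemma exc_eq_card_inv_lt {n : ℕ} (σ : Equiv.Perm (Fin n)) :
    exc σ = (Finset.univ.filter fun y => σ⁻¹ y < y).card := by
  rw [exc]
  exact Finset.card_equiv σ fun x => by simp

/-! ### Inversions under swaps and increasing cycles -/

lemma inv_eq_sum {n : ℕ} (σ : Equiv.Perm (Fin n)) :
    (inv σ : ℤ) = ∑ u, ∑ v, if u < v ∧ σ v < σ u then 1 else 0 := by
  rw [inv, Finset.card_filter, ← Finset.univ_product_univ, Finset.sum_product]
  push_cast
  rfl

lemma inv_inv {n : ℕ} (σ : Equiv.Perm (Fin n)) : inv σ⁻¹ = inv σ := by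
  have h : (inv σ⁻¹ : ℤ) = inv σ := by
    rw [inv_eq_sum, inv_eq_sum, Finset.sum_comm, ← Equiv.sum_comp σ]
    refine Finset.sum_congr rfl fun u _ => ?_
    rw [← Equiv.sum_comp σ]
    refine Finset.sum_congr rfl fun v _ => ?_
    simp only [Equiv.Perm.inv_def, Equiv.symm_apply_apply, and_comm]
  exact_mod_cast h

/-- A third index `z` gains with `x` what it loses with `y`, because of `hgap`; the pair `{x, y}`
itself becomes an inversion. -/
lemma inv_mul_swap {n : ℕ} (σ : Equiv.Perm (Fin n)) {x y : Fin n} (hxy : x < y)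
    (hσ : σ x < σ y) (hgap : ∀ z, x < z → z < y → σ x < σ z → ¬ σ z < σ y) :
    inv (σ * Equiv.swap x y) = inv σ + 1 := by
  set s := Equiv.swap x y with hs
  -- After reindexing by `s`, the values are kept and their positions are moved: `F u v` is the
  -- change in the contribution of the values `σ u`, `σ v`.
  let F : Fin n → Fin n → ℤ := fun u v =>
    (if s u < s v ∧ σ v < σ u then 1 else 0) - (if u < v ∧ σ v < σ u then 1 else 0)
  have key : (inv (σ * s) : ℤ) - inv σ = ∑ u, ∑ v, F u v := by
    have h1 : (inv (σ * s) : ℤ) = ∑ u, ∑ v, if s u < s v ∧ σ v < σ u then 1 else 0 := by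
      rw [inv_eq_sum, ← Equiv.sum_comp s]
      refine Finset.sum_congr rfl fun u _ => ?_
      rw [← Equiv.sum_comp s]
      refine Finset.sum_congr rfl fun v _ => ?_
      simp [hs, Equiv.Perm.mul_apply]
    rw [h1, inv_eq_sum, ← Finset.sum_sub_distrib]
    exact Finset.sum_congr rfl fun u _ => (Finset.sum_sub_distrib _ _).symm
  have hsx : s x = y := Equiv.swap_apply_left x y
  have hsy : s y = x := Equiv.swap_apply_right x y
  have hsz : ∀ z, z ≠ x → z ≠ y → s z = z := fun z => Equiv.swap_apply_of_ne_of_ne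
  have hin : ∀ z ∈ ({x, y} : Finset (Fin n))ᶜ, z ≠ x ∧ z ≠ y := by
    intro z hz
    simpa only [Finset.mem_compl, Finset.mem_insert, Finset.mem_singleton, not_or] using hz
  have hzero : ∀ u ∈ ({x, y} : Finset (Fin n))ᶜ, ∀ v ∈ ({x, y} : Finset (Fin n))ᶜ, F u v = 0 := by
    intro u hu v hv
    simp only [F, hsz u (hin u hu).1 (hin u hu).2, hsz v (hin v hv).1 (hin v hv).2, sub_self]
  have hrow : ∀ z ∈ ({x, y} : Finset (Fin n))ᶜ, F z x + F z y = 0 ∧ F x z + F y z = 0 := by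
    intro z hz
    obtain ⟨hzx, hzy⟩ := hin z hz
    have hg := hgap z
    have h1 : σ z ≠ σ x := fun h => hzx (σ.injective h)
    have h2 : σ z ≠ σ y := fun h => hzy (σ.injective h)
    simp only [F, hsx, hsy, hsz z hzx hzy]
    simp only [Fin.lt_def, ne_eq, Fin.ext_iff] at *
    constructor <;> split_ifs <;> omega
  have hsum : ∑ u, ∑ v, F u v = 1 := by
    have hu : ∀ u ∈ ({x, y} : Finset (Fin n))ᶜ, ∑ v, F u v = 0 := by
      intro u hu
      rw [sum_eq_add_add_sum_compl hxy.ne, (hrow u hu).1, Finset.sum_eq_zero (hzero u hu), add_zero]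
    rw [sum_eq_add_add_sum_compl hxy.ne, Finset.sum_eq_zero hu, add_zero,
      sum_eq_add_add_sum_compl hxy.ne (F x), sum_eq_add_add_sum_compl hxy.ne (F y)]
    have hc := Finset.sum_eq_zero fun z hz => (hrow z hz).2
    rw [Finset.sum_add_distrib] at hc
    have h4 : F x x + F x y + (F y x + F y y) = 1 := by
      simp [F, hsx, hsy, hxy, hσ, hσ.not_gt, hxy.not_gt]
    linarith
  omega

/-- The cycle carries the value `π a` rightwards past the larger values on the list, one swap at a
time. After the first swap this value sits at `b`, so the hypotheses pass to the tail, and every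
swap creates one inversion. -/
lemma inv_mul_formPerm {n : ℕ} (l : List (Fin n)) : ∀ (a : Fin n) (π : Equiv.Perm (Fin n)),
    (a :: l).Pairwise (· < ·) → (∀ v ∈ l, π a < π v) →
    (∀ w ∈ l, ∀ v, a < v → v < w → v ∉ l → π v < π a) →
    inv (π * (a :: l).formPerm) = inv π + l.length := by
  induction l with
  | nil => intro a π _ _ _; simp
  | cons b l ih =>
    intro a π hs hlt hgap
    rw [List.pairwise_cons] at hs
    obtain ⟨hab, hs⟩ := hs
    have hbl := (List.pairwise_cons.1 hs).1
    have hab' : a < b := hab b (by simp)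
    rw [List.formPerm_cons_cons, ← mul_assoc]
    have hmv : ∀ v, a ≠ v → b ≠ v → (π * Equiv.swap a b) v = π v := fun v h1 h2 => by
      rw [Equiv.Perm.mul_apply, Equiv.swap_apply_of_ne_of_ne h1.symm h2.symm]
    have hmb : (π * Equiv.swap a b) b = π a := by simp
    rw [ih b _ hs, inv_mul_swap π hab' (hlt b (by simp)), List.length_cons]
    · omega
    · intro z h1 h2 h3 _
      refine absurd (hgap b (by simp) z h1 h2 ?_) h3.not_gt
      intro hz
      rcases List.mem_cons.1 hz with rfl | hz
      · exact lt_irrefl _ h2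
      · exact lt_asymm h2 (hbl z hz)
    · intro v hv
      rw [hmb, hmv v (hab v (by simp [hv])).ne (hbl v hv).ne]
      exact hlt v (by simp [hv])
    · intro w hw v h1 h2 hv
      rw [hmb, hmv v (hab'.trans h1).ne h1.ne]
      exact hgap w (by simp [hw]) v (hab'.trans h1) h2 (by simp [hv, h1.ne'])

/-- The cyclic permutation of the elements of `S` that are `≥ a`, moving each to the next one. -/
def cyc {n : ℕ} (S : Finset (Fin n)) (a : Fin n) : Equiv.Perm (Fin n) :=
  (a :: (S.filter (a < ·)).sort).formPerm

lemma cyc_apply_of_notMem {n : ℕ} {S : Finset (Fin n)} {a x : Fin n} (ha : a ∈ S) (hx : x ∉ S) :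
    cyc S a x = x := by
  refine List.formPerm_apply_of_notMem ?_
  rw [List.mem_cons, Finset.mem_sort, Finset.mem_filter, not_or]
  exact ⟨fun h => hx (h ▸ ha), fun h => hx h.1⟩

lemma cyc_mem_iff {n : ℕ} {S : Finset (Fin n)} {a x : Fin n} (ha : a ∈ S) :
    cyc S a x ∈ S ↔ x ∈ S := by
  by_cases hx : x ∈ S
  · refine ⟨fun _ => hx, fun _ => ?_⟩
    by_contra h
    have := cyc_apply_of_notMem ha h
    rw [(cyc S a).injective this] at h
    exact h hx
  · rw [cyc_apply_of_notMem ha hx]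

lemma pairwise_cons_sort {n : ℕ} (S : Finset (Fin n)) (a : Fin n) :
    (a :: (S.filter (a < ·)).sort).Pairwise (· < ·) := by
  rw [List.pairwise_cons]
  refine ⟨fun b hb => ?_, (Finset.sortedLT_sort _).pairwise⟩
  rw [Finset.mem_sort, Finset.mem_filter] at hb
  exact hb.2

lemma cyc_apply_max {n : ℕ} {S : Finset (Fin n)} {a m : Fin n} (ha : a ∈ S) (hm : m ∈ S)
    (hmax : ∀ x ∈ S, x ≤ m) : cyc S a m = a := by
  have hlast : (a :: (S.filter (a < ·)).sort).getLast (List.cons_ne_nil _ _) = m := by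
    have hmem : m ∈ a :: (S.filter (a < ·)).sort := by
      rw [List.mem_cons, Finset.mem_sort, Finset.mem_filter]
      rcases (hmax a ha).eq_or_lt with h | h
      · exact Or.inl h.symm
      · exact Or.inr ⟨hm, h⟩
    apply le_antisymm
    · have := List.getLast_mem (List.cons_ne_nil a (S.filter (a < ·)).sort)
      rcases List.mem_cons.1 this with h | h
      · rw [h]; exact hmax a ha
      · rw [Finset.mem_sort, Finset.mem_filter] at h
        exact hmax _ h.1
    · have hp := (pairwise_cons_sort S a).imp (S := (· ≤ ·)) le_of_lt
      exact hp.rel_getLast hmem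
  conv_lhs => rw [cyc, ← hlast]
  exact List.formPerm_apply_getLast a _

lemma inv_mul_cyc {n : ℕ} {S : Finset (Fin n)} {a m : Fin n} (π : Equiv.Perm (Fin n))
    (hmax : ∀ x ∈ S, x ≤ m) (h1 : ∀ v ∈ S, a < v → π a < π v)
    (h2 : ∀ v, v < m → v ∉ S → a < v → π v < π a) :
    inv (π * cyc S a) = inv π + (S.filter (a < ·)).card := by
  rw [cyc, inv_mul_formPerm _ _ _ (pairwise_cons_sort S a), Finset.length_sort]
  · intro v hv
    rw [Finset.mem_sort, Finset.mem_filter] at hv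
    exact h1 v hv.1 hv.2
  · intro w hw v hav hvw hv
    rw [Finset.mem_sort, Finset.mem_filter] at hw hv
    exact h2 v (hvw.trans_le (hmax w hw.1)) (fun h => hv ⟨h, hav⟩) hav

lemma perm_apply_inv {α : Type*} (σ : Equiv.Perm α) (x : α) : σ (σ⁻¹ x) = x :=
  σ.apply_symm_apply x

lemma perm_inv_apply {α : Type*} (σ : Equiv.Perm α) (x : α) : σ⁻¹ (σ x) = x :=
  σ.symm_apply_apply x

/-! ### Matching two sets by rank from the top -/

/-- The number of elements of `S` above `a`. -/
def above {n : ℕ} (S : Finset (Fin n)) (a : Fin n) : ℕ := (S.filter (a < ·)).card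

lemma above_lt_above {n : ℕ} {S : Finset (Fin n)} {a b : Fin n} (hb : b ∈ S) (h : a < b) :
    above S b < above S a := by
  refine Finset.card_lt_card ((Finset.ssubset_iff_of_subset ?_).2 ⟨b, ?_, ?_⟩)
  · intro x hx
    rw [Finset.mem_filter] at hx ⊢
    exact ⟨hx.1, h.trans hx.2⟩
  · exact Finset.mem_filter.2 ⟨hb, h⟩
  · simp

lemma above_injOn {n : ℕ} (S : Finset (Fin n)) : Set.InjOn (above S) S := by
  intro a ha b hb h
  rcases lt_trichotomy a b with hlt | rfl | hlt
  · exact absurd h (above_lt_above hb hlt).ne'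
  · rfl
  · exact absurd h (above_lt_above ha hlt).ne

lemma above_lt_card {n : ℕ} {S : Finset (Fin n)} {a : Fin n} (ha : a ∈ S) :
    above S a < S.card :=
  Finset.card_lt_card (Finset.filter_ssubset.2 ⟨a, ha, lt_irrefl a⟩)

/-- `above T` is injective from `T` into `{0, …, |T| - 1}`, hence onto. -/
lemma exists_above_eq {n : ℕ} {S T : Finset (Fin n)} (hc : S.card = T.card) {a : Fin n}
    (ha : a ∈ S) : ∃ b ∈ T, above T b = above S a := by
  have := Finset.surjOn_of_injOn_of_card_le (s := T) (t := Finset.range T.card) (above T)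
    (fun b hb => by simpa using above_lt_card hb) (above_injOn T) (by simp)
  obtain ⟨b, hb, h⟩ := this (show above S a ∈ (Finset.range T.card : Set ℕ) by
    simpa using hc ▸ above_lt_card ha)
  exact ⟨b, hb, h⟩

open Classical in
/-- The element of `T` of the same rank from the top as the element `a` of `S`. -/
noncomputable def rankMatch {n : ℕ} (S T : Finset (Fin n)) (a : Fin n) : Fin n :=
  if h : ∃ b ∈ T, above T b = above S a then h.choose else a

lemma rankMatch_spec {n : ℕ} {S T : Finset (Fin n)} (hc : S.card = T.card) {a : Fin n}
    (ha : a ∈ S) : rankMatch S T a ∈ T ∧ above T (rankMatch S T a) = above S a := by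
  have h := exists_above_eq hc ha
  rw [rankMatch, dif_pos h]
  exact h.choose_spec

lemma rankMatch_rankMatch {n : ℕ} {S T : Finset (Fin n)} (hc : S.card = T.card) {a : Fin n}
    (ha : a ∈ S) : rankMatch T S (rankMatch S T a) = a := by
  have h1 := rankMatch_spec hc ha
  have h2 := rankMatch_spec hc.symm h1.1
  exact above_injOn S h2.1 ha (h2.2.trans h1.2)

/-! ### The cut after `i` -/

/-- The positions `< i` with values beyond `i`, together with `i`. -/
def openPos {n : ℕ} (i : Fin n) (σ : Equiv.Perm (Fin n)) : Finset (Fin n) :=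
  Finset.univ.filter fun x => x = i ∨ x < i ∧ i < σ x

/-- The values `≤ i` taken at positions `≥ i`. -/
def openVal {n : ℕ} (i : Fin n) (σ : Equiv.Perm (Fin n)) : Finset (Fin n) :=
  Finset.univ.filter fun y => y ≤ i ∧ i ≤ σ⁻¹ y

lemma mem_openPos {n : ℕ} {i x : Fin n} {σ : Equiv.Perm (Fin n)} :
    x ∈ openPos i σ ↔ x = i ∨ x < i ∧ i < σ x := by simp [openPos]

lemma mem_openVal {n : ℕ} {i y : Fin n} {σ : Equiv.Perm (Fin n)} :
    y ∈ openVal i σ ↔ y ≤ i ∧ i ≤ σ⁻¹ y := by simp [openVal]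

/-- Both sets are complements in `Iic i`: of the positions `< i` with value `≤ i`, and of the values
taken there. -/
lemma card_openVal {n : ℕ} (i : Fin n) (σ : Equiv.Perm (Fin n)) :
    (openVal i σ).card = (openPos i σ).card := by
  set A := Finset.univ.filter fun x => x < i ∧ σ x ≤ i with hA
  have h1 : openPos i σ = Finset.Iic i \ A := by
    ext x
    simp only [mem_openPos, hA, Finset.mem_sdiff, Finset.mem_Iic, Finset.mem_filter,
      Finset.mem_univ, true_and, not_and, not_le]
    constructor
    · rintro (rfl | h)
      · exact ⟨le_rfl, fun h => absurd h (lt_irrefl _)⟩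
      · exact ⟨h.1.le, fun _ => h.2⟩
    · rintro ⟨h1, h2⟩
      exact h1.eq_or_lt.imp id fun h => ⟨h, h2 h⟩
  have h2 : openVal i σ = Finset.Iic i \ A.map σ.toEmbedding := by
    ext y
    simp only [mem_openVal, hA, Finset.mem_sdiff, Finset.mem_Iic, Finset.mem_map_equiv,
      Finset.mem_filter, Finset.mem_univ, true_and, not_and, not_le, Equiv.apply_symm_apply,
      Equiv.Perm.inv_def]
    exact and_congr_right fun h => ⟨fun h1 h2 => absurd h1 h2.not_ge,
      fun h1 => not_lt.1 fun h2 => (h1 h2).not_ge h⟩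
  rw [h1, h2, Finset.card_sdiff_of_subset, Finset.card_sdiff_of_subset, Finset.card_map]
  · intro x hx
    simp only [hA, Finset.mem_filter] at hx
    exact Finset.mem_Iic.2 hx.2.1.le
  · intro y hy
    simp only [hA, Finset.mem_map_equiv, Finset.mem_filter, Equiv.apply_symm_apply] at hy
    exact Finset.mem_Iic.2 hy.2.2

/-- `σ` and `τ` agree on the points that do not cross the cut after `i`. -/
def Agree {n : ℕ} (i j : Fin n) (σ τ : Equiv.Perm (Fin n)) : Prop :=
  (∀ x, x < i → (σ x ≤ i ∨ τ x ≤ i) → τ x = σ x) ∧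
    ∀ x, i < x → (j < σ x ∨ j < τ x) → τ x = σ x

lemma Agree.symm {n : ℕ} {i j : Fin n} {σ τ : Equiv.Perm (Fin n)} (h : Agree i j σ τ) :
    Agree i j τ σ :=
  ⟨fun x hx h' => (h.1 x hx h'.symm).symm, fun x hx h' => (h.2 x hx h'.symm).symm⟩

/-- Together with `Agree.openVal_eq`, this lets the inverse move be built from the same two sets as
the move. -/
lemma Agree.openPos_eq {n : ℕ} {i j : Fin n} {σ τ : Equiv.Perm (Fin n)} (h : Agree i j σ τ) :
    openPos i τ = openPos i σ := by
  ext x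
  rw [mem_openPos, mem_openPos]
  refine or_congr_right (and_congr_right fun hx => ?_)
  by_cases h' : σ x ≤ i ∨ τ x ≤ i
  · rw [h.1 x hx h']
  · push Not at h'
    exact ⟨fun _ => h'.1, fun _ => h'.2⟩

lemma Agree.openVal_subset {n : ℕ} {i j : Fin n} {σ τ : Equiv.Perm (Fin n)} (h : Agree i j σ τ) :
    openVal i τ ⊆ openVal i σ := by
  intro y hy
  rw [mem_openVal] at hy ⊢
  refine ⟨hy.1, not_lt.1 fun hlt => ?_⟩
  have := h.1 _ hlt (Or.inl (by simpa using hy.1))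
  rw [perm_apply_inv, ← Equiv.Perm.eq_inv_iff_eq] at this
  exact (this ▸ hlt).not_ge hy.2

lemma Agree.openVal_eq {n : ℕ} {i j : Fin n} {σ τ : Equiv.Perm (Fin n)} (h : Agree i j σ τ) :
    openVal i τ = openVal i σ :=
  h.openVal_subset.antisymm h.symm.openVal_subset

/-- An altered value at `k < i` exceeds `i` in both permutations, so `k` is an excedance in both.
One at `k > i` is at most `j ≤ k` in both, so `k` is an excedance in neither. -/
lemma Agree.lt_apply_iff {n : ℕ} {i j : Fin n} {σ τ : Equiv.Perm (Fin n)} (h : Agree i j σ τ)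
    (hij : (j : ℕ) = i + 1) {k : Fin n} (hk : k ≠ i) : k < τ k ↔ k < σ k := by
  rcases lt_or_gt_of_ne hk with hk | hk
  · by_cases h' : σ k ≤ i ∨ τ k ≤ i
    · rw [h.1 k hk h']
    · push Not at h'
      exact ⟨fun _ => hk.trans h'.1, fun _ => hk.trans h'.2⟩
  · by_cases h' : j < σ k ∨ j < τ k
    · rw [h.2 k hk h']
    · push Not at h'
      have hjk : j ≤ k := by rw [Fin.le_def, hij]; exact hk
      exact ⟨fun h1 => absurd (h1.trans_le (h'.2.trans hjk)) (lt_irrefl _),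
        fun h1 => absurd (h1.trans_le (h'.1.trans hjk)) (lt_irrefl _)⟩

lemma Agree.inv_lt_of_inv_lt {n : ℕ} {i j : Fin n} {σ τ : Equiv.Perm (Fin n)}
    (h : Agree i j σ τ) (hij : (j : ℕ) = i + 1) {k : Fin n} (hk : k ≠ j) (hlt : σ⁻¹ k < k) :
    τ⁻¹ k < k := by
  have hij' : i < j := by rw [Fin.lt_def]; omega
  rcases lt_or_gt_of_ne hk with hk | hk
  · have hki : k ≤ i := by rw [Fin.lt_def] at hk; rw [Fin.le_def]; omega
    have := h.1 _ (hlt.trans_le hki) (Or.inl (by simpa using hki))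
    rw [perm_apply_inv, ← Equiv.Perm.eq_inv_iff_eq] at this
    rwa [← this]
  · by_cases hx : i < τ⁻¹ k
    · have := h.2 _ hx (Or.inr (by simpa using hk))
      rw [perm_apply_inv, eq_comm, ← Equiv.Perm.eq_inv_iff_eq] at this
      rwa [this]
    · exact (not_lt.1 hx).trans_lt (hij'.trans hk)

lemma Agree.inv_lt_iff {n : ℕ} {i j : Fin n} {σ τ : Equiv.Perm (Fin n)}
    (h : Agree i j σ τ) (hij : (j : ℕ) = i + 1) {k : Fin n} (hk : k ≠ j) :
    τ⁻¹ k < k ↔ σ⁻¹ k < k :=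
  ⟨h.symm.inv_lt_of_inv_lt hij hk, h.inv_lt_of_inv_lt hij hk⟩

/-! ### Low and high permutations and the moves between them -/

/-- Neither the position `i` nor the value `j` belongs to an excedance. -/
def Low {n : ℕ} (i j : Fin n) (σ : Equiv.Perm (Fin n)) : Prop := ¬ i < σ i ∧ ¬ σ⁻¹ j < j

/-- Both the position `i` and the value `j` belong to excedances. -/
def High {n : ℕ} (i j : Fin n) (σ : Equiv.Perm (Fin n)) : Prop := i < σ i ∧ σ⁻¹ j < j

/-- Move the value `j` and the position `i` of a permutation that is low at `i, j` into
excedances. -/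
noncomputable def toHigh {n : ℕ} (i j : Fin n) (σ : Equiv.Perm (Fin n)) : Equiv.Perm (Fin n) :=
  (cyc (insert j (openVal i σ)) (σ i))⁻¹ * σ *
    (cyc (openPos i σ) (rankMatch (openVal i σ) (openPos i σ) (σ i)))⁻¹

/-- The inverse operation of `toHigh`. -/
noncomputable def toLow {n : ℕ} (i j : Fin n) (σ : Equiv.Perm (Fin n)) : Equiv.Perm (Fin n) :=
  cyc (insert j (openVal i σ)) (rankMatch (openPos i σ) (openVal i σ) (σ⁻¹ j)) * σ *
    cyc (openPos i σ) (σ⁻¹ j)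

lemma inv_cyc_apply_of_notMem {n : ℕ} {S : Finset (Fin n)} {a x : Fin n} (ha : a ∈ S)
    (hx : x ∉ S) : (cyc S a)⁻¹ x = x := by
  rw [Equiv.Perm.inv_eq_iff_eq, cyc_apply_of_notMem ha hx]

lemma inv_cyc_mem_iff {n : ℕ} {S : Finset (Fin n)} {a x : Fin n} (ha : a ∈ S) :
    (cyc S a)⁻¹ x ∈ S ↔ x ∈ S := by
  rw [← cyc_mem_iff ha, perm_apply_inv]

section Moves

variable {n : ℕ} {i j : Fin n}

lemma lt_of_val_eq (hij : (j : ℕ) = i + 1) : i < j := by rw [Fin.lt_def]; omega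

lemma lt_iff_le_of_val_eq (hij : (j : ℕ) = i + 1) {x : Fin n} : x < j ↔ x ≤ i := by
  rw [Fin.lt_def, Fin.le_def]; omega

lemma lt_of_lt_of_ne (hij : (j : ℕ) = i + 1) {x : Fin n} (h : i < x) (hne : x ≠ j) : j < x := by
  refine lt_of_not_ge fun h' => ?_
  exact absurd ((lt_iff_le_of_val_eq hij).1 (h'.lt_of_ne hne)) h.not_ge

lemma le_of_mem_openPos {σ : Equiv.Perm (Fin n)} {x : Fin n} (h : x ∈ openPos i σ) : x ≤ i := by
  rcases mem_openPos.1 h with rfl | h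
  · exact le_rfl
  · exact h.1.le

lemma le_of_mem_insert_openVal (hij : (j : ℕ) = i + 1) {σ : Equiv.Perm (Fin n)} {y : Fin n}
    (h : y ∈ insert j (openVal i σ)) : y ≤ j := by
  rcases Finset.mem_insert.1 h with rfl | h
  · exact le_rfl
  · exact (mem_openVal.1 h).1.trans (lt_of_val_eq hij).le

lemma notMem_insert_openVal (hij : (j : ℕ) = i + 1) {σ : Equiv.Perm (Fin n)} {y : Fin n}
    (h : j < y) : y ∉ insert j (openVal i σ) :=
  fun h' => h.not_ge (le_of_mem_insert_openVal hij h')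

lemma notMem_openPos {σ : Equiv.Perm (Fin n)} {x : Fin n} (hx : x < i) (h : σ x ≤ i) :
    x ∉ openPos i σ := by
  rw [mem_openPos, not_or]
  exact ⟨hx.ne, fun h' => h'.2.not_ge h⟩

lemma apply_notMem_insert_openVal (hij : (j : ℕ) = i + 1) {σ : Equiv.Perm (Fin n)} {x : Fin n}
    (hx : x < i) (h : σ x ≤ i) : σ x ∉ insert j (openVal i σ) := by
  rw [Finset.mem_insert, mem_openVal, not_or]
  refine ⟨(h.trans_lt (lt_of_val_eq hij)).ne, fun h' => ?_⟩
  rw [perm_inv_apply] at h'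
  exact h'.2.not_gt hx

lemma Low.apply_mem_openVal {σ : Equiv.Perm (Fin n)} (h : Low i j σ) : σ i ∈ openVal i σ := by
  rw [mem_openVal, perm_inv_apply]
  exact ⟨not_lt.1 h.1, le_rfl⟩

lemma High.inv_mem_openPos (hij : (j : ℕ) = i + 1) {τ : Equiv.Perm (Fin n)} (h : High i j τ) :
    τ⁻¹ j ∈ openPos i τ := by
  rw [mem_openPos, perm_apply_inv]
  exact ((lt_iff_le_of_val_eq hij).1 h.2).eq_or_lt.imp id fun h' => ⟨h', lt_of_val_eq hij⟩

/-- The inverse cycle on positions sends `p` to `i`, and the one on values sends `σ i` to `j`, so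
the value `j` lands at `p`. Other open positions only exchange values above `j`, which the value
cycle fixes. -/
lemma toHigh_spec (hij : (j : ℕ) = i + 1) {σ : Equiv.Perm (Fin n)} (h : Low i j σ) :
    Agree i j σ (toHigh i j σ) ∧ High i j (toHigh i j σ) ∧
      (toHigh i j σ)⁻¹ j = rankMatch (openVal i σ) (openPos i σ) (σ i) := by
  set p := rankMatch (openVal i σ) (openPos i σ) (σ i) with hp
  set τ := toHigh i j σ with hτ
  have hpP : p ∈ openPos i σ := (rankMatch_spec (card_openVal i σ) h.apply_mem_openVal).1
  have haW : σ i ∈ insert j (openVal i σ) := Finset.mem_insert_of_mem h.apply_mem_openVal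
  have happ : ∀ x, τ x = (cyc (insert j (openVal i σ)) (σ i))⁻¹
      (σ ((cyc (openPos i σ) p)⁻¹ x)) := fun x => rfl
  have hBa : (cyc (insert j (openVal i σ)) (σ i))⁻¹ (σ i) = j := by
    rw [Equiv.Perm.inv_eq_iff_eq, cyc_apply_max haW (Finset.mem_insert_self _ _)
      fun x hx => le_of_mem_insert_openVal hij hx]
  have hAp : (cyc (openPos i σ) p)⁻¹ p = i := by
    rw [Equiv.Perm.inv_eq_iff_eq, cyc_apply_max hpP (mem_openPos.2 (Or.inl rfl))
      fun x hx => le_of_mem_openPos hx]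
  have hopen : ∀ x ∈ openPos i σ, i < τ x := by
    intro x hx
    rw [happ]
    rw [← inv_cyc_mem_iff hpP] at hx
    rcases mem_openPos.1 hx with hx | hx
    · rw [hx, hBa]
      exact lt_of_val_eq hij
    -- Lowness keeps the value `j` away from positions before `j`.
    · have hne : σ ((cyc (openPos i σ) p)⁻¹ x) ≠ j := by
        intro he
        rw [← Equiv.Perm.eq_inv_iff_eq] at he
        exact h.2 (he ▸ hx.1.trans (lt_of_val_eq hij))
      rw [inv_cyc_apply_of_notMem haW (notMem_insert_openVal hij (lt_of_lt_of_ne hij hx.2 hne))]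
      exact hx.2
  have hclosed : ∀ x, x < i → σ x ≤ i → τ x = σ x := fun x hx hσ => by
    rw [happ, inv_cyc_apply_of_notMem hpP (notMem_openPos hx hσ),
      inv_cyc_apply_of_notMem haW (apply_notMem_insert_openVal hij hx hσ)]
  have hinv : τ⁻¹ j = p := by
    rw [Equiv.Perm.inv_eq_iff_eq, happ, hAp, hBa]
  refine ⟨⟨fun x hx hx' => ?_, fun x hx hx' => ?_⟩, ⟨hopen i (mem_openPos.2 (Or.inl rfl)), ?_⟩,
    hinv⟩
  · refine hclosed x hx (not_lt.1 fun hlt => ?_)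
    exact hx'.elim hlt.not_ge (hopen x (mem_openPos.2 (Or.inr ⟨hx, hlt⟩))).not_ge
  · have hA : (cyc (openPos i σ) p)⁻¹ x = x :=
      inv_cyc_apply_of_notMem hpP fun hx' => hx.not_ge (le_of_mem_openPos hx')
    rw [happ, hA] at hx' ⊢
    refine inv_cyc_apply_of_notMem haW fun hmem => ?_
    rcases hx' with hx' | hx'
    · exact notMem_insert_openVal hij hx' hmem
    · exact notMem_insert_openVal hij hx' ((inv_cyc_mem_iff haW).2 hmem)
  · rw [hinv, lt_iff_le_of_val_eq hij]
    exact le_of_mem_openPos hpP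

lemma toLow_spec (hij : (j : ℕ) = i + 1) {τ : Equiv.Perm (Fin n)} (h : High i j τ) :
    Agree i j τ (toLow i j τ) ∧ Low i j (toLow i j τ) ∧
      toLow i j τ i = rankMatch (openPos i τ) (openVal i τ) (τ⁻¹ j) := by
  set a := rankMatch (openPos i τ) (openVal i τ) (τ⁻¹ j) with ha
  set σ := toLow i j τ with hσ
  have hpP : τ⁻¹ j ∈ openPos i τ := h.inv_mem_openPos hij
  have haV : a ∈ openVal i τ := (rankMatch_spec (card_openVal i τ).symm hpP).1
  have haW : a ∈ insert j (openVal i τ) := Finset.mem_insert_of_mem haV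
  have happ : ∀ x, σ x = cyc (insert j (openVal i τ)) a (τ (cyc (openPos i τ) (τ⁻¹ j) x)) :=
    fun x => rfl
  have hAi : cyc (openPos i τ) (τ⁻¹ j) i = τ⁻¹ j :=
    cyc_apply_max hpP (mem_openPos.2 (Or.inl rfl)) fun x hx => le_of_mem_openPos hx
  have hσi : σ i = a := by
    rw [happ, hAi, perm_apply_inv, cyc_apply_max haW (Finset.mem_insert_self _ _)
      fun x hx => le_of_mem_insert_openVal hij hx]
  have hopen : ∀ x ∈ openPos i τ, x ≠ i → j < σ x := by
    intro x hx hxi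
    have hne : τ (cyc (openPos i τ) (τ⁻¹ j) x) ≠ j := by
      intro he
      rw [← Equiv.Perm.eq_inv_iff_eq] at he
      exact hxi ((cyc _ _).injective (he.trans hAi.symm))
    rw [← cyc_mem_iff hpP] at hx
    have hlt : i < τ (cyc (openPos i τ) (τ⁻¹ j) x) := by
      rcases mem_openPos.1 hx with hx | hx
      · rw [hx]; exact h.1
      · exact hx.2
    have hlt' := lt_of_lt_of_ne hij hlt hne
    rwa [happ, cyc_apply_of_notMem haW (notMem_insert_openVal hij hlt')]
  have hclosed : ∀ x, x < i → τ x ≤ i → σ x = τ x := fun x hx hx' => by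
    rw [happ, cyc_apply_of_notMem hpP (notMem_openPos hx hx'),
      cyc_apply_of_notMem haW (apply_notMem_insert_openVal hij hx hx')]
  refine ⟨⟨fun x hx hx' => ?_, fun x hx hx' => ?_⟩, ⟨?_, fun hlt => ?_⟩, hσi⟩
  · refine hclosed x hx (not_lt.1 fun hlt => ?_)
    have := hopen x (mem_openPos.2 (Or.inr ⟨hx, hlt⟩)) hx.ne
    exact hx'.elim hlt.not_ge ((lt_of_val_eq hij).trans this).not_ge
  · have hA : cyc (openPos i τ) (τ⁻¹ j) x = x :=
      cyc_apply_of_notMem hpP fun hx' => hx.not_ge (le_of_mem_openPos hx')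
    rw [happ, hA] at hx' ⊢
    refine cyc_apply_of_notMem haW fun hmem => ?_
    rcases hx' with hx' | hx'
    · exact notMem_insert_openVal hij hx' hmem
    · exact notMem_insert_openVal hij hx' ((cyc_mem_iff haW).2 hmem)
  · rw [hσi]
    exact (mem_openVal.1 haV).1.not_gt
  · have hσx : σ (σ⁻¹ j) = j := perm_apply_inv _ _
    rcases ((lt_iff_le_of_val_eq hij).1 hlt).eq_or_lt with hx | hx
    · rw [hx, hσi] at hσx
      exact (mem_openVal.1 haV).1.not_gt (hσx ▸ lt_of_val_eq hij)
    · by_cases hτ : τ (σ⁻¹ j) ≤ i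
      · rw [← hclosed _ hx hτ, hσx] at hτ
        exact hτ.not_gt (lt_of_val_eq hij)
      · exact (hopen _ (mem_openPos.2 (Or.inr ⟨hx, not_le.1 hτ⟩)) hx.ne).ne hσx.symm

/-- The open sets are unchanged and rank matching is reversible, so both moves use the same two
cycles, which cancel. -/
lemma toLow_toHigh (hij : (j : ℕ) = i + 1) {σ : Equiv.Perm (Fin n)} (h : Low i j σ) :
    toLow i j (toHigh i j σ) = σ := by
  obtain ⟨hag, -, hp⟩ := toHigh_spec hij h
  rw [toLow, hag.openPos_eq, hag.openVal_eq, hp,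
    rankMatch_rankMatch (card_openVal i σ) h.apply_mem_openVal, toHigh]
  group

lemma toHigh_toLow (hij : (j : ℕ) = i + 1) {τ : Equiv.Perm (Fin n)} (h : High i j τ) :
    toHigh i j (toLow i j τ) = τ := by
  obtain ⟨hag, -, hp⟩ := toLow_spec hij h
  rw [toHigh, hag.openPos_eq, hag.openVal_eq, hp,
    rankMatch_rankMatch (card_openVal i τ).symm (h.inv_mem_openPos hij), toLow]
  group

/-- Undoing only one of the two cycles from either side gives mutually inverse permutations, hence
equal inversion numbers. The cycles contribute the ranks of `σ i` and `τ⁻¹ j`; these match except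
that the added `j` lies above `σ i`, which is the extra 1. -/
lemma inv_toHigh (hij : (j : ℕ) = i + 1) {σ : Equiv.Perm (Fin n)} (h : Low i j σ) :
    inv (toHigh i j σ) = inv σ + 1 := by
  obtain ⟨hag, hhigh, hp⟩ := toHigh_spec hij h
  have haV := h.apply_mem_openVal
  have hrank := rankMatch_spec (card_openVal i σ) haV
  have hτ : toHigh i j σ = (cyc (insert j (openVal i σ)) (σ i))⁻¹ * σ *
    (cyc (openPos i σ) (rankMatch (openVal i σ) (openPos i σ) (σ i)))⁻¹ := rfl
  rw [← hp] at hrank hτ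
  set τ := toHigh i j σ
  have h1 : inv (σ⁻¹ * cyc (insert j (openVal i σ)) (σ i)) =
      inv σ⁻¹ + ((insert j (openVal i σ)).filter (σ i < ·)).card := by
    refine inv_mul_cyc (m := j) _ (fun x hx => le_of_mem_insert_openVal hij hx) ?_ ?_
    · intro v hv hlt
      rw [perm_inv_apply]
      rcases Finset.mem_insert.1 hv with rfl | hv
      · exact (lt_of_val_eq hij).trans_le (not_lt.1 h.2)
      · refine (mem_openVal.1 hv).2.lt_of_ne fun he => hlt.ne ?_
        rw [he, perm_apply_inv]
    · intro v hvj hv _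
      rw [perm_inv_apply]
      refine not_le.1 fun hle => hv (Finset.mem_insert_of_mem (mem_openVal.2 ⟨?_, hle⟩))
      exact (lt_iff_le_of_val_eq hij).1 hvj
  have h2 : inv (τ * cyc (openPos i σ) (τ⁻¹ j)) =
      inv τ + ((openPos i σ).filter (τ⁻¹ j < ·)).card := by
    rw [← hag.openPos_eq]
    refine inv_mul_cyc (m := i) _ (fun x hx => le_of_mem_openPos hx) ?_ ?_
    · intro v hv hlt
      rw [perm_apply_inv]
      refine lt_of_lt_of_ne hij ?_ fun he => hlt.ne ?_
      · rcases mem_openPos.1 hv with rfl | hv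
        · exact hhigh.1
        · exact hv.2
      · rw [← he, perm_inv_apply]
    · intro v hvi hv _
      rw [perm_apply_inv]
      refine lt_of_le_of_lt (not_lt.1 fun hlt => ?_) (lt_of_val_eq hij)
      exact hv (mem_openPos.2 (Or.inr ⟨hvi, hlt⟩))
  have h3 : inv (τ * cyc (openPos i σ) (τ⁻¹ j)) =
      inv (σ⁻¹ * cyc (insert j (openVal i σ)) (σ i)) := by
    have : τ * cyc (openPos i σ) (τ⁻¹ j) = (σ⁻¹ * cyc (insert j (openVal i σ)) (σ i))⁻¹ := by
      generalize cyc (openPos i σ) (τ⁻¹ j) = A at hτ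
      rw [hτ]
      group
    rw [this, inv_inv]
  have h4 : ((insert j (openVal i σ)).filter (σ i < ·)).card =
      ((openVal i σ).filter (σ i < ·)).card + 1 := by
    rw [Finset.filter_insert, if_pos ((not_lt.1 h.1).trans_lt (lt_of_val_eq hij)),
      Finset.card_insert_of_notMem]
    rw [Finset.mem_filter, mem_openVal]
    exact fun h' => h'.1.1.not_gt (lt_of_val_eq hij)
  have h5 := hrank.2
  rw [inv_inv] at h1
  unfold above at h5
  omega

/-- The set of excedance positions gains exactly `i` and that of excedance values exactly `j = i +
1`. -/
lemma Agree.exc_and_depth {σ τ : Equiv.Perm (Fin n)} (hag : Agree i j σ τ)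
    (hij : (j : ℕ) = i + 1) (hσ : Low i j σ) (hτ : High i j τ) :
    exc τ = exc σ + 1 ∧ depth τ = depth σ + 1 := by
  have h1 : (Finset.univ.filter fun x => x < τ x) =
      insert i (Finset.univ.filter fun x => x < σ x) := by
    ext x
    simp only [Finset.mem_filter, Finset.mem_univ, true_and, Finset.mem_insert]
    by_cases hx : x = i
    · simp [hx, hτ.1]
    · simp [hx, hag.lt_apply_iff hij hx]
  have h2 : (Finset.univ.filter fun y => τ⁻¹ y < y) =
      insert j (Finset.univ.filter fun y => σ⁻¹ y < y) := by
    ext y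
    simp only [Finset.mem_filter, Finset.mem_univ, true_and, Finset.mem_insert]
    by_cases hy : y = j
    · simp only [hy, hτ.2, true_or]
    · simp only [hy, hag.inv_lt_iff hij hy, false_or]
  have hi : i ∉ Finset.univ.filter fun x => x < σ x := by simpa using hσ.1
  have hj : j ∉ Finset.univ.filter fun y => σ⁻¹ y < y := fun h =>
    hσ.2 (Finset.mem_filter.1 h).2
  have h3 := depth_add_sum τ
  have h4 := depth_add_sum σ
  rw [h1, h2, Finset.sum_insert hi, Finset.sum_insert hj] at h3
  refine ⟨?_, by omega⟩
  rw [exc, h1, Finset.card_insert_of_notMem hi, exc]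

/-! ### The involution -/

open Classical in
/-- Exchange low and high at `i, j`. -/
noncomputable def flip (i j : Fin n) (σ : Equiv.Perm (Fin n)) : Equiv.Perm (Fin n) :=
  if Low i j σ then toHigh i j σ else toLow i j σ

/-- `σ` is low or high at `i, j`. -/
def Level (i j : Fin n) (σ : Equiv.Perm (Fin n)) : Prop := Low i j σ ∨ High i j σ

lemma not_low_of_high {σ : Equiv.Perm (Fin n)} (h : High i j σ) : ¬ Low i j σ :=
  fun h' => h'.1 h.1

lemma flip_flip (hij : (j : ℕ) = i + 1) {σ : Equiv.Perm (Fin n)} (h : Level i j σ) :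
    flip i j (flip i j σ) = σ := by
  rcases h with h | h
  · rw [flip, flip, if_pos h, if_neg (not_low_of_high (toHigh_spec hij h).2.1),
      toLow_toHigh hij h]
  · rw [flip, flip, if_neg (not_low_of_high h), if_pos (toLow_spec hij h).2.1,
      toHigh_toLow hij h]

lemma agree_flip (hij : (j : ℕ) = i + 1) {σ : Equiv.Perm (Fin n)} (h : Level i j σ) :
    Agree i j σ (flip i j σ) := by
  rcases h with h | h
  · rw [flip, if_pos h]
    exact (toHigh_spec hij h).1
  · rw [flip, if_neg (not_low_of_high h)]
    exact (toLow_spec hij h).1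

lemma level_flip (hij : (j : ℕ) = i + 1) {σ : Equiv.Perm (Fin n)} (h : Level i j σ) :
    Level i j (flip i j σ) := by
  rcases h with h | h
  · rw [flip, if_pos h]
    exact Or.inr (toHigh_spec hij h).2.1
  · rw [flip, if_neg (not_low_of_high h)]
    exact Or.inl (toLow_spec hij h).2.1

lemma flip_stats (hij : (j : ℕ) = i + 1) {σ : Equiv.Perm (Fin n)} (h : Level i j σ) :
    (depth (flip i j σ) = depth σ + 1 ∧ exc (flip i j σ) = exc σ + 1 ∧
      inv (flip i j σ) = inv σ + 1) ∨
    (depth σ = depth (flip i j σ) + 1 ∧ exc σ = exc (flip i j σ) + 1 ∧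
      inv σ = inv (flip i j σ) + 1) := by
  rcases h with h | h
  · left
    rw [flip, if_pos h]
    obtain ⟨hag, hh, -⟩ := toHigh_spec hij h
    have := hag.exc_and_depth hij h hh
    exact ⟨this.2, this.1, inv_toHigh hij h⟩
  · right
    rw [flip, if_neg (not_low_of_high h)]
    obtain ⟨hag, hl, -⟩ := toLow_spec hij h
    have := hag.symm.exc_and_depth hij hl h
    have h' := inv_toHigh hij hl
    rw [toHigh_toLow hij h] at h'
    exact ⟨this.2, this.1, h'⟩

/-- `i` is the first index at which `σ` is low or high. -/
def IsFirst (i j : Fin n) (σ : Equiv.Perm (Fin n)) : Prop :=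
  (j : ℕ) = i + 1 ∧ Level i j σ ∧ ∀ i' j' : Fin n, (j' : ℕ) = i' + 1 → i' < i → ¬ Level i' j' σ

lemma IsFirst.unique {i' j' : Fin n} {σ : Equiv.Perm (Fin n)} (h : IsFirst i j σ)
    (h' : IsFirst i' j' σ) : i = i' ∧ j = j' := by
  have hi : i = i' := by
    rcases lt_trichotomy i i' with hlt | he | hlt
    · exact absurd h.2.1 (h'.2.2 i j h.1 hlt)
    · exact he
    · exact absurd h'.2.1 (h.2.2 i' j' h'.1 hlt)
  subst hi
  exact ⟨rfl, Fin.ext (h.1.trans h'.1.symm)⟩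

lemma exists_isFirst {σ : Equiv.Perm (Fin n)} (hij : (j : ℕ) = i + 1) (h : Level i j σ) :
    ∃ i j, IsFirst i j σ := by
  induction i using WellFoundedLT.induction generalizing j with
  | ind i ih =>
    by_cases h' : ∃ i' j' : Fin n, (j' : ℕ) = i' + 1 ∧ i' < i ∧ Level i' j' σ
    · obtain ⟨i', j', h1, h2, h3⟩ := h'
      exact ih i' h2 h1 h3
    · push Not at h'
      exact ⟨i, j, hij, h, h'⟩

lemma IsFirst.flip {σ : Equiv.Perm (Fin n)} (h : IsFirst i j σ) :
    IsFirst i j (PermDepth.flip i j σ) := by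
  refine ⟨h.1, level_flip h.1 h.2.1, fun i' j' hij' hlt hl => h.2.2 i' j' hij' hlt ?_⟩
  have hag := agree_flip h.1 h.2.1
  have hj : j' ≠ j := by
    intro he
    rw [he] at hij'
    have := h.1
    rw [Fin.lt_def] at hlt
    omega
  simpa only [Level, Low, High, hag.lt_apply_iff h.1 hlt.ne, hag.inv_lt_iff h.1 hj] using hl

open Classical in
/-- The involution: exchange low and high at the first possible index. -/
noncomputable def involution (σ : Equiv.Perm (Fin n)) : Equiv.Perm (Fin n) :=
  if h : ∃ q : Fin n × Fin n, IsFirst q.1 q.2 σ then flip h.choose.1 h.choose.2 σ else σ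

lemma IsFirst.involution_eq {σ : Equiv.Perm (Fin n)} (h : IsFirst i j σ) :
    involution σ = PermDepth.flip i j σ := by
  have hex : ∃ q : Fin n × Fin n, IsFirst q.1 q.2 σ := ⟨(i, j), h⟩
  rw [involution, dif_pos hex]
  obtain ⟨h1, h2⟩ := h.unique hex.choose_spec
  rw [← h1, ← h2]

lemma involution_eq_self {σ : Equiv.Perm (Fin n)} (h : ¬ ∃ i j, IsFirst i j σ) :
    involution σ = σ := by
  rw [involution, dif_neg]
  rintro ⟨q, hq⟩
  exact h ⟨_, _, hq⟩

lemma involution_involutive : Function.Involutive (involution (n := n)) := by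
  intro σ
  by_cases h : ∃ i j, IsFirst i j σ
  · obtain ⟨i, j, h⟩ := h
    rw [h.involution_eq, h.flip.involution_eq, flip_flip h.1 h.2.1]
  · rw [involution_eq_self h, involution_eq_self h]

lemma involution_stats (σ : Equiv.Perm (Fin n)) :
    (depth (involution σ) = depth σ + 1 ∧ exc (involution σ) = exc σ + 1 ∧
      inv (involution σ) = inv σ + 1) ∨
    (depth σ = depth (involution σ) + 1 ∧ exc σ = exc (involution σ) + 1 ∧
      inv σ = inv (involution σ) + 1) ∨ involution σ = σ := by
  by_cases h : ∃ i j, IsFirst i j σ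
  · obtain ⟨i, j, h⟩ := h
    rw [h.involution_eq]
    rcases flip_stats h.1 h.2.1 with h | h
    · exact Or.inl h
    · exact Or.inr (Or.inl h)
  · exact Or.inr (Or.inr (involution_eq_self h))

lemma not_level_of_involution_eq {σ : Equiv.Perm (Fin n)} (h : involution σ = σ)
    (hij : (j : ℕ) = i + 1) : ¬ Level i j σ := by
  intro hl
  obtain ⟨i', j', h'⟩ := exists_isFirst hij hl
  have := flip_stats h'.1 h'.2.1
  rw [← h'.involution_eq, h] at this
  omega

end Moves

/-! ### The excedance enumerator and its differential recurrence -/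

/-- The weight of a permutation, with a factor `x` for each excedance and `y` for each other
index. -/
def weight {R : Type*} [CommRing R] (x y : R) {n : ℕ} (σ : Equiv.Perm (Fin n)) : R :=
  ∏ i, if i < σ i then x else y

lemma weight_decomposeFin_zero {R : Type*} [CommRing R] (x y : R) {n : ℕ}
    (σ : Equiv.Perm (Fin n)) :
    weight x y (Equiv.Perm.decomposeFin.symm (0, σ)) = y * weight x y σ := by
  rw [weight, Fin.prod_univ_succ, weight]
  simp

/-- A new least element is inserted into the arc `z → σ z`: it becomes an excedance, and `z` now
maps to it and is not one. The factor at `z` is thus replaced by `x * y`. -/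
lemma weight_decomposeFin_succ {R : Type*} [CommRing R] (x y : R) {n : ℕ}
    (σ : Equiv.Perm (Fin n)) (z : Fin n) :
    weight x y (Equiv.Perm.decomposeFin.symm ((σ z).succ, σ)) =
      (∏ i ∈ Finset.univ.erase z, if i < σ i then x else y) * (x * y) := by
  rw [weight, Fin.prod_univ_succ, ← Finset.mul_prod_erase Finset.univ _ (Finset.mem_univ z)]
  have : ∀ i ∈ Finset.univ.erase z,
      (if i.succ < Equiv.Perm.decomposeFin.symm ((σ z).succ, σ) i.succ then x else y) =
        if i < σ i then x else y := by
    intro i hi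
    rw [Equiv.Perm.decomposeFin_symm_apply_succ, Equiv.swap_apply_of_ne_of_ne]
    · simp
    · exact Fin.succ_ne_zero _
    · simpa using (Finset.mem_erase.1 hi).1
  rw [Finset.prod_congr rfl this]
  simp
  ring

lemma derivation_prod {R A ι : Type*} [CommRing R] [CommRing A] [Algebra A R] [DecidableEq ι]
    (D : Derivation A R R) (s : Finset ι) (f : ι → R) :
    D (∏ i ∈ s, f i) = ∑ z ∈ s, (∏ i ∈ s.erase z, f i) * D (f z) := by
  induction s using Finset.induction_on with
  | empty => simp
  | insert a s ha ih =>
    rw [Finset.prod_insert ha, Finset.sum_insert ha, D.leibniz, ih, Finset.erase_insert ha,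
      smul_eq_mul, smul_eq_mul, add_comm, Finset.mul_sum]
    congr 1
    refine Finset.sum_congr rfl fun z hz => ?_
    have hne : a ≠ z := fun h => ha (h ▸ hz)
    rw [Finset.erase_insert_of_ne hne, Finset.prod_insert fun h => ha (Finset.mem_of_mem_erase h),
      mul_assoc]

/-- Insertion as a fixed point gives the factor `y`. Insertion into an arc replaces one factor by `x
* y`, which is what `D` does by the Leibniz rule. -/
lemma sum_weight_succ {R A : Type*} [CommRing R] [CommRing A] [Algebra A R]
    (D : Derivation A R R) {x y : R} (hx : D x = x * y) (hy : D y = x * y) (n : ℕ) :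
    ∑ σ : Equiv.Perm (Fin (n + 1)), weight x y σ =
      y * (∑ σ : Equiv.Perm (Fin n), weight x y σ) + D (∑ σ : Equiv.Perm (Fin n), weight x y σ) := by
  rw [← Equiv.sum_comp Equiv.Perm.decomposeFin.symm, Fintype.sum_prod_type, Fin.sum_univ_succ]
  simp only [weight_decomposeFin_zero]
  rw [Finset.mul_sum, map_sum, Finset.sum_comm]
  congr 1
  refine Finset.sum_congr rfl fun σ _ => ?_
  rw [← Equiv.sum_comp σ]
  simp only [weight_decomposeFin_succ]
  rw [weight, derivation_prod]
  refine Finset.sum_congr rfl fun z _ => ?_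
  congr 1
  split_ifs
  · exact hx.symm
  · exact hy.symm

lemma iterate_derivation_eq {R A : Type*} [CommRing R] [CommRing A] [Algebra A R]
    (D : Derivation A R R) {x y w : R} (hx : D x = x * y) (hy : D y = x * y) (hw : D w = y * w)
    (n : ℕ) : (⇑D)^[n] w = w * ∑ σ : Equiv.Perm (Fin n), weight x y σ := by
  induction n with
  | zero => simp [weight]
  | succ n ih =>
    rw [Function.iterate_succ_apply', ih, D.leibniz, hw, sum_weight_succ D hx hy, smul_eq_mul,
      smul_eq_mul]
    ring

lemma weight_neg_one_one {R : Type*} [CommRing R] {n : ℕ} (σ : Equiv.Perm (Fin n)) :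
    weight (-1 : R) 1 σ = (-1) ^ exc σ := by
  rw [weight, Finset.prod_ite, Finset.prod_const, Finset.prod_const, one_pow, mul_one, exc]

lemma map_weight {R S : Type*} [CommRing R] [CommRing S] (f : R →+* S) (x y : R) {n : ℕ}
    (σ : Equiv.Perm (Fin n)) : f (weight x y σ) = weight (f x) (f y) σ := by
  rw [weight, map_prod, weight]
  simp only [apply_ite f]

/-! ### The tangent series and the signed excedance sum -/

open PowerSeries

lemma derivative_sin : derivative ℚ (PowerSeries.sin ℚ) = PowerSeries.cos ℚ := by
  ext n
  rw [coeff_derivative, PowerSeries.sin, PowerSeries.cos, coeff_mk, coeff_mk]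
  rcases Nat.even_or_odd n with h | h
  · have h' : ¬ Even (n + 1) := by simpa [Nat.even_add_one] using h
    obtain ⟨k, rfl⟩ := h
    rw [if_neg h', if_pos ⟨k, rfl⟩, Nat.factorial_succ]
    have e1 : (k + k + 1) / 2 = k := by omega
    have e2 : (k + k) / 2 = k := by omega
    have := Nat.factorial_ne_zero (k + k)
    rw [e1, e2]
    simp only [Algebra.algebraMap_self, RingHom.id_apply]
    push_cast
    field_simp
  · have h' : Even (n + 1) := by simpa [Nat.even_add_one] using h
    rw [if_pos h', if_neg (Nat.not_even_iff_odd.2 h), zero_mul]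

lemma derivative_cos : derivative ℚ (PowerSeries.cos ℚ) = -PowerSeries.sin ℚ := by
  ext n
  rw [coeff_derivative, map_neg, PowerSeries.sin, PowerSeries.cos, coeff_mk, coeff_mk]
  rcases Nat.even_or_odd n with h | h
  · have h' : ¬ Even (n + 1) := by simpa [Nat.even_add_one] using h
    rw [if_neg h', if_pos h, zero_mul, neg_zero]
  · have h' : Even (n + 1) := by simpa [Nat.even_add_one] using h
    obtain ⟨k, rfl⟩ := h
    rw [if_pos h', if_neg (Nat.not_even_iff_odd.2 ⟨k, rfl⟩), Nat.factorial_succ]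
    have e1 : (2 * k + 1 + 1) / 2 = k + 1 := by omega
    have e2 : (2 * k + 1) / 2 = k := by omega
    have := Nat.factorial_ne_zero (2 * k + 1)
    rw [e1, e2]
    simp only [Algebra.algebraMap_self, RingHom.id_apply]
    push_cast
    field_simp
    ring

lemma constantCoeff_cos : constantCoeff (PowerSeries.cos ℚ) = 1 := by
  rw [← coeff_zero_eq_constantCoeff_apply, PowerSeries.cos, coeff_mk]
  simp

lemma constantCoeff_sin : constantCoeff (PowerSeries.sin ℚ) = 0 := by
  rw [← coeff_zero_eq_constantCoeff_apply, PowerSeries.sin, coeff_mk]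
  simp

lemma cos_mul_inv_cos : PowerSeries.cos ℚ * (PowerSeries.cos ℚ)⁻¹ = 1 :=
  PowerSeries.mul_inv_cancel _ (by simp [constantCoeff_cos])

/-- The tangent power series. -/
noncomputable def tan : ℚ⟦X⟧ := PowerSeries.sin ℚ * (PowerSeries.cos ℚ)⁻¹

lemma derivative_tan : derivative ℚ tan = 1 + tan ^ 2 := by
  rw [tan, Derivation.leibniz, derivative_inv', derivative_sin, derivative_cos, smul_eq_mul,
    smul_eq_mul]
  linear_combination cos_mul_inv_cos

/-- The secant is even, being the inverse of an even series, so only the tangent contributes to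
`euler n` for odd `n`. -/
lemma coeff_inv_cos_of_odd {n : ℕ} (hn : Odd n) : coeff n (PowerSeries.cos ℚ)⁻¹ = 0 := by
  have hcos : rescale (-1 : ℚ) (PowerSeries.cos ℚ) = PowerSeries.cos ℚ := by
    ext m
    rw [coeff_rescale, PowerSeries.cos, coeff_mk]
    split_ifs with h
    · rw [h.neg_one_pow, one_mul]
    · rw [mul_zero]
  have h1 : PowerSeries.cos ℚ * rescale (-1 : ℚ) (PowerSeries.cos ℚ)⁻¹ = 1 := by
    have := congrArg (rescale (-1 : ℚ)) cos_mul_inv_cos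
    rwa [map_mul, hcos, map_one] at this
  have h2 : rescale (-1 : ℚ) (PowerSeries.cos ℚ)⁻¹ = (PowerSeries.cos ℚ)⁻¹ := by
    linear_combination (PowerSeries.cos ℚ)⁻¹ * h1 -
      rescale (-1 : ℚ) (PowerSeries.cos ℚ)⁻¹ * cos_mul_inv_cos
  have h3 := congrArg (coeff n) h2
  rw [coeff_rescale, hn.neg_one_pow] at h3
  linarith

lemma euler_of_odd {n : ℕ} (hn : Odd n) : euler n = n.factorial * coeff n tan := by
  rw [euler, map_add, coeff_inv_cos_of_odd hn, add_zero, tan]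

/-- The tangent power series over `ℂ`. -/
noncomputable def tanC : ℂ⟦X⟧ := PowerSeries.map (algebraMap ℚ ℂ) tan

lemma derivative_tanC : derivative ℂ tanC = 1 + tanC ^ 2 := by
  have h : derivative ℂ tanC = PowerSeries.map (algebraMap ℚ ℂ) (derivative ℚ tan) := by
    ext n
    simp only [tanC, coeff_derivative, coeff_map, map_mul, map_add, map_natCast, map_one]
  rw [h, derivative_tan, map_add, map_one, map_pow, tanC]

lemma constantCoeff_tanC : constantCoeff tanC = 0 := by
  rw [← coeff_zero_eq_constantCoeff_apply, tanC, coeff_map, tan, coeff_zero_eq_constantCoeff_apply,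
    map_mul, constantCoeff_sin, zero_mul, map_zero]

lemma sum_neg_one_pow_exc_complex {n : ℕ} (hn : 1 ≤ n) :
    (∑ σ : Equiv.Perm (Fin n), (-1 : ℂ) ^ exc σ) * Complex.I ^ n =
      Complex.I * (n.factorial * (coeff n tan : ℚ)) := by
  have hI : (C Complex.I : ℂ⟦X⟧) * C Complex.I = -1 := by
    rw [← map_mul, Complex.I_mul_I, map_neg, map_one]
  set J : ℂ⟦X⟧ := C Complex.I with hJ
  -- With `T = tanC` and `J² = -1`, the factorization `1 + T² = (1 + JT)(1 - JT)` yields the three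
  -- differential equations below. At the origin `x = -1`, `y = 1` and `w = 1`, so the weights
  -- become signs.
  let D : Derivation ℂ ℂ⟦X⟧ ℂ⟦X⟧ := (-Complex.I) • derivative ℂ
  have hDT : D tanC = -J * (1 + tanC ^ 2) := by
    simp only [D, Derivation.smul_apply, derivative_tanC, smul_eq_C_mul, map_neg, hJ]
  have hDJ : ∀ f : ℂ⟦X⟧, D (J * f) = J * D f := by
    intro f
    rw [D.leibniz, smul_eq_mul, smul_eq_mul]
    simp only [D, Derivation.smul_apply, hJ, derivative_C, smul_zero, mul_zero, add_zero]
  have hit := iterate_derivation_eq D (x := -(1 + J * tanC)) (y := 1 - J * tanC)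
    (w := 1 + J * tanC)
    (by
      rw [map_neg, map_add, D.map_one_eq_zero, hDJ, hDT]
      linear_combination (1 : ℂ⟦X⟧) * hI)
    (by
      rw [map_sub, D.map_one_eq_zero, hDJ, hDT]
      linear_combination (1 : ℂ⟦X⟧) * hI)
    (by
      rw [map_add, D.map_one_eq_zero, hDJ, hDT]
      linear_combination (-1 : ℂ⟦X⟧) * hI) n
  have hD : ∀ m, ∀ f : ℂ⟦X⟧, (⇑D)^[m] f = (-Complex.I) ^ m • (⇑(derivative ℂ))^[m] f := by
    intro m f
    induction m with
    | zero => simp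
    | succ m ih =>
      rw [Function.iterate_succ_apply', ih, Function.iterate_succ_apply', D.map_smul]
      simp only [D, Derivation.smul_apply, smul_smul, pow_succ]
  rw [hD] at hit
  have hc := congrArg (constantCoeff (R := ℂ)) hit
  have hcoeff : coeff n (1 + J * tanC) = Complex.I * (coeff n tan : ℚ) := by
    rw [map_add, coeff_one, if_neg (by omega), hJ, coeff_C_mul, zero_add, tanC, coeff_map]
    rfl
  rw [smul_eq_C_mul, map_mul, map_mul, constantCoeff_C, constantCoeff_iterate_derivative, hcoeff,
    map_sum] at hc
  simp only [map_weight, map_neg, map_sub, map_add, map_mul, map_one, constantCoeff_tanC, mul_zero,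
    add_zero, sub_zero, weight_neg_one_one, one_mul] at hc
  rw [← hc]
  have : (-Complex.I) ^ n * Complex.I ^ n = 1 := by
    rw [← mul_pow, neg_mul, Complex.I_mul_I, neg_neg, one_pow]
  linear_combination (Complex.I * (n.factorial * (coeff n tan : ℚ))) * this

theorem sum_neg_one_pow_exc {n : ℕ} (hn : 1 ≤ n) :
    ∑ σ : Equiv.Perm (Fin n), (-1 : ℚ) ^ exc σ =
      if Odd n then (-1) ^ ((n - 1) / 2) * euler n else 0 := by
  have h := sum_neg_one_pow_exc_complex hn
  have hS : (∑ σ : Equiv.Perm (Fin n), (-1 : ℂ) ^ exc σ) =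
      ((∑ σ : Equiv.Perm (Fin n), (-1 : ℚ) ^ exc σ : ℚ) : ℂ) := by push_cast; rfl
  rw [hS] at h
  set S := ∑ σ : Equiv.Perm (Fin n), (-1 : ℚ) ^ exc σ
  split_ifs with ho
  · rw [euler_of_odd ho]
    obtain ⟨k, rfl⟩ := ho
    rw [pow_succ, pow_mul, Complex.I_sq] at h
    have h' : (S : ℂ) * (-1) ^ k = (2 * k + 1).factorial * (coeff (2 * k + 1) tan : ℚ) := by
      apply mul_right_cancel₀ Complex.I_ne_zero
      linear_combination h
    have h2 : S * (-1) ^ k = (2 * k + 1).factorial * coeff (2 * k + 1) tan := by exact_mod_cast h'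
    rw [show (2 * k + 1 - 1) / 2 = k by omega, ← h2]
    have : ((-1 : ℚ) ^ k) * (-1) ^ k = 1 := by rw [← mul_pow]; simp
    linear_combination (-S) * this
  · rw [Nat.not_odd_iff_even] at ho
    obtain ⟨k, rfl⟩ := ho
    rw [← two_mul, pow_mul, Complex.I_sq] at h
    -- The left side is real and the right side purely imaginary, so both vanish.
    have h' := congrArg Complex.re h
    have e1 : (S : ℂ) * (-1) ^ k = ((S * (-1) ^ k : ℚ) : ℂ) := by push_cast; rfl
    have e2 : (((2 * k).factorial : ℂ) * (coeff (2 * k) tan : ℚ)) =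
      (((2 * k).factorial * coeff (2 * k) tan : ℚ) : ℂ) := by push_cast; rfl
    rw [e1, e2, Complex.ratCast_re, Complex.mul_re, Complex.I_re, Complex.ratCast_im, zero_mul,
      mul_zero, sub_zero] at h'
    have h2 : S * (-1) ^ k = 0 := by exact_mod_cast h'
    simpa using h2

/-! ### Fixed points: statistics and number -/

/-- For each `k < n - 1` exactly one of "position `k`" and "value `k + 1`" belongs to an excedance.
Counting these gives the first claim; summing them with weight `k + 1` gives the second, through
`depth_add_sum`. -/
lemma fixed_two_mul_exc {n : ℕ} {σ : Equiv.Perm (Fin n)} (hn : 1 ≤ n)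
    (h : ∀ i j : Fin n, (j : ℕ) = i + 1 → ¬ Level i j σ) :
    2 * exc σ = n - 1 ∧ depth σ + exc σ + 2 * (∑ x with x < σ x, (x : ℕ)) = n * (n - 1) / 2 := by
  obtain ⟨m, rfl⟩ : ∃ m, n = m + 1 := ⟨n - 1, by omega⟩
  have hex : ∀ k : Fin m, (k.castSucc < σ k.castSucc ↔ ¬ σ⁻¹ k.succ < k.succ) := by
    intro k
    have := h k.castSucc k.succ (by simp)
    unfold Level Low High at this
    tauto
  have hlast : ¬ Fin.last m < σ (Fin.last m) := (Fin.le_last _).not_gt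
  -- The last position and the value 0 never belong to excedances, so the pairs `(k, k + 1)` account
  -- for everything.
  have hzero : ¬ σ⁻¹ 0 < 0 := (Fin.zero_le _).not_gt
  have e1 : exc σ = ∑ k : Fin m, if k.castSucc < σ k.castSucc then 1 else 0 := by
    rw [exc, Finset.card_filter, Fin.sum_univ_castSucc, if_neg hlast, add_zero]
  have e2 : exc σ = ∑ k : Fin m, if σ⁻¹ k.succ < k.succ then 1 else 0 := by
    rw [exc_eq_card_inv_lt, Finset.card_filter, Fin.sum_univ_succ, if_neg hzero, zero_add]
  have e3 : ∑ x with x < σ x, (x : ℕ) = ∑ k : Fin m, if k.castSucc < σ k.castSucc then (k : ℕ)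
      else 0 := by
    rw [Finset.sum_filter, Fin.sum_univ_castSucc, if_neg hlast, add_zero]
    simp only [Fin.val_castSucc]
  have e4 : ∑ y with σ⁻¹ y < y, (y : ℕ) = ∑ k : Fin m, if σ⁻¹ k.succ < k.succ then (k : ℕ) + 1
      else 0 := by
    rw [Finset.sum_filter, Fin.sum_univ_succ, if_neg hzero, zero_add]
    simp only [Fin.val_succ]
  have s1 : exc σ + exc σ = m := by
    nth_rw 1 [e1]
    rw [e2, ← Finset.sum_add_distrib]
    have : ∀ k : Fin m, ((if k.castSucc < σ k.castSucc then 1 else 0) +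
        if σ⁻¹ k.succ < k.succ then 1 else 0) = 1 := by
      intro k
      have := hex k
      split_ifs <;> first | rfl | (exfalso; tauto)
    rw [Finset.sum_congr rfl fun k _ => this k, Finset.sum_const, Finset.card_univ, Fintype.card_fin,
      smul_eq_mul, mul_one]
  have s2 : exc σ + ∑ x with x < σ x, (x : ℕ) + ∑ y with σ⁻¹ y < y, (y : ℕ) =
      ∑ k : Fin m, ((k : ℕ) + 1) := by
    rw [e1, e3, e4, ← Finset.sum_add_distrib, ← Finset.sum_add_distrib]
    refine Finset.sum_congr rfl fun k _ => ?_
    have := hex k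
    split_ifs <;> omega
  have s3 : ∑ k : Fin m, ((k : ℕ) + 1) = (m + 1) * (m + 1 - 1) / 2 := by
    rw [Fin.sum_univ_eq_sum_range (fun k => k + 1) m, ← Finset.sum_range_id,
      Finset.sum_range_succ' (fun k => k) m, add_zero]
  have := depth_add_sum σ
  constructor <;> omega

lemma fixed_spec {n : ℕ} (hn : 1 ≤ n) {σ : Equiv.Perm (Fin n)} (h : involution σ = σ) :
    Odd n ∧ exc σ = (n - 1) / 2 ∧ Even (depth σ) := by
  obtain ⟨h1, h2⟩ := fixed_two_mul_exc hn fun i j hij => not_level_of_involution_eq h hij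
  refine ⟨⟨exc σ, by omega⟩, by omega, ?_⟩
  have hn' : n = 2 * exc σ + 1 := by omega
  generalize exc σ = k at *
  subst hn'
  have h3 : (2 * k + 1) * (2 * k + 1 - 1) / 2 = k + 2 * k * k := by
    rw [Nat.add_sub_cancel]
    apply Nat.div_eq_of_eq_mul_left two_pos
    ring
  rw [h3] at h2
  have h4 : depth σ = 2 * (k * k) - 2 * (∑ x with x < σ x, (x : ℕ)) := by
    rw [← mul_assoc]
    omega
  rw [h4, ← Nat.mul_sub]
  exact even_two_mul _

open Classical in
/-- A sign-valued sum over all permutations reduces to the fixed points of the involution. -/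
lemma sum_neg_one_pow_eq_card {n : ℕ} (s : Equiv.Perm (Fin n) → ℕ) (e : ℕ)
    (hs : ∀ σ, s (involution σ) = s σ + 1 ∨ s σ = s (involution σ) + 1 ∨ involution σ = σ)
    (he : ∀ σ, involution σ = σ → (-1 : ℚ) ^ s σ = (-1) ^ e) :
    ∑ σ, (-1 : ℚ) ^ s σ =
      (-1) ^ e * (Nat.card {σ : Equiv.Perm (Fin n) // involution σ = σ} : ℕ) := by
  rw [← Finset.sum_filter_add_sum_filter_not Finset.univ
    (fun σ : Equiv.Perm (Fin n) => involution σ = σ)]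
  have h1 : ∑ σ : Equiv.Perm (Fin n) with ¬ involution σ = σ, (-1 : ℚ) ^ s σ = 0 := by
    refine Finset.sum_involution (fun σ _ => involution σ) ?_ ?_ ?_ ?_
    · intro σ hσ
      rcases hs σ with h | h | h
      · rw [h, pow_succ]; ring
      · rw [h, pow_succ]; ring
      · exact absurd h (Finset.mem_filter.1 hσ).2
    · intro σ hσ _
      exact (Finset.mem_filter.1 hσ).2
    · intro σ hσ
      rw [Finset.mem_filter, involution_involutive σ]
      exact ⟨Finset.mem_univ _, fun h => (Finset.mem_filter.1 hσ).2 h.symm⟩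
    · intro σ _
      exact involution_involutive σ
  rw [h1, add_zero, Finset.sum_congr rfl fun σ hσ => he σ (Finset.mem_filter.1 hσ).2,
    Finset.sum_const, nsmul_eq_mul, mul_comm, Nat.card_eq_fintype_card, Fintype.card_subtype]

/-- All fixed points have the same excedance number `(n - 1) / 2`, so the known signed sum is, up to
that sign, their number. -/
theorem card_fixed {n : ℕ} (hn : 1 ≤ n) :
    ((Nat.card {σ : Equiv.Perm (Fin n) // involution σ = σ} : ℕ) : ℚ) =
      if Odd n then euler n else 0 := by
  have h := sum_neg_one_pow_eq_card (n := n) exc ((n - 1) / 2)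
    (fun σ => (involution_stats σ).imp (·.2.1) (Or.imp (·.2.1) id))
    (fun σ hσ => by rw [(fixed_spec hn hσ).2.1])
  rw [sum_neg_one_pow_exc hn] at h
  have hne : ((-1 : ℚ) ^ ((n - 1) / 2)) ≠ 0 := pow_ne_zero _ (by norm_num)
  apply mul_left_cancel₀ hne
  rw [← h]
  split_ifs <;> simp

theorem sum_neg_one_pow_depth {n : ℕ} (hn : 1 ≤ n) :
    ∑ σ : Equiv.Perm (Fin n), (-1 : ℚ) ^ depth σ = if Odd n then euler n else 0 := by
  rw [sum_neg_one_pow_eq_card depth 0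
    (fun σ => (involution_stats σ).imp (·.1) (Or.imp (·.1) id))
    (fun σ hσ => by rw [(fixed_spec hn hσ).2.2.neg_one_pow, pow_zero]), card_fixed hn, pow_zero,
    one_mul]

end PermDepth

theorem theorem2 (n : ℕ) (hn : 1 ≤ n) :
    (∃ f : Equiv.Perm (Fin n) → Equiv.Perm (Fin n),
      Function.Involutive f ∧
      (∀ σ : Equiv.Perm (Fin n),
        (PermDepth.depth σ : ℤ) - (PermDepth.depth (f σ) : ℤ)
            = (PermDepth.exc σ : ℤ) - (PermDepth.exc (f σ) : ℤ) ∧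
        (PermDepth.exc σ : ℤ) - (PermDepth.exc (f σ) : ℤ)
            = (PermDepth.inv σ : ℤ) - (PermDepth.inv (f σ) : ℤ) ∧
        (PermDepth.inv σ : ℤ) - (PermDepth.inv (f σ) : ℤ) ∈ ({1, 0, -1} : Set ℤ)) ∧
      (∀ σ : Equiv.Perm (Fin n), f σ ≠ σ →
        (PermDepth.depth σ : ℤ) - (PermDepth.depth (f σ) : ℤ) ≠ 0) ∧
      (∀ σ : Equiv.Perm (Fin n), f σ = σ →
        Even (PermDepth.depth σ) ∧ PermDepth.exc σ ≡ (n - 1) / 2 [MOD 2]) ∧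
      ((Nat.card {σ : Equiv.Perm (Fin n) // f σ = σ} : ℕ) : ℚ)
        = if Odd n then PermDepth.euler n else 0) ∧
    (∑ σ : Equiv.Perm (Fin n), (-1 : ℚ) ^ PermDepth.depth σ
      = if Odd n then PermDepth.euler n else 0) ∧
    (∑ σ : Equiv.Perm (Fin n), (-1 : ℚ) ^ PermDepth.exc σ
      = if Odd n then (-1 : ℚ) ^ ((n - 1) / 2) * PermDepth.euler n else 0) := by
  refine ⟨⟨PermDepth.involution, PermDepth.involution_involutive, fun σ => ?_, fun σ hσ => ?_,
    fun σ hσ => ?_, PermDepth.card_fixed hn⟩, PermDepth.sum_neg_one_pow_depth hn,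
    PermDepth.sum_neg_one_pow_exc hn⟩
  · simp only [Set.mem_insert_iff, Set.mem_singleton_iff]
    rcases PermDepth.involution_stats σ with h | h | h
    · omega
    · omega
    · simp [h]
  · rcases PermDepth.involution_stats σ with h | h | h
    · omega
    · omega
    · exact absurd h hσ
  · obtain ⟨-, h1, h2⟩ := PermDepth.fixed_spec hn hσ
    exact ⟨h2, by rw [h1]⟩
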